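/- Let $n\ge 1$ and $\hat\theta\in\mathbb R$. In terms of the eigenvalues $\lambda=(\lambda_1,\dots,\lambda_n)\in\mathbb R^n$ of $\omega^{-1}\chi$ at a point, the deformed Hermitian--Yang--Mills equation $\operatorname{Im}(\omega+\sqrt{-1}\,\chi)^n=\tan\hat\theta\cdot\operatorname{Re}(\omega+\sqrt{-1}\,\chi)^n$ reads $$\cos\hat\theta\cdot\operatorname{Im}\prod_{j=1}^n(1+\sqrt{-1}\,\lambda_j)=\sin\hat\theta\cdot\operatorname{Re}\prod_{j=1}^n(1+\sqrt{-1}\,\lambda_j)\qquad(*)$$ (multiplied by $\cos\hat\theta$, so that it also makes sense where $\tan\hat\theta$ is infinite). Let $S_{\hat\theta}=\{\lambda\in\mathbb R^n:\sum_{i=1}^n\arctan\lambda_i=\hat\theta\}$, and let $\Gamma_n=\{\lambda\in\mathbb R^n:\lambda_i>0\text{ for all }i\}$. (a) If $\hat\theta$ is a supercritical phase, that is, $\hat\theta\in\bigl((n-2)\tfrac{\pi}{2},\,n\tfrac{\pi}{2}\bigr)$, then the level set of the equation is convex. More precisely, $S_{\hat\theta}$ is a connected component of the solution set of $(*)$,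 and it is the only one that is contained in $q+\Gamma_n$ for some $q\in\mathbb R^n$; moreover, the region $\{\lambda:\sum_i\arctan\lambda_i>\hat\theta\}$ is a nonempty convex open proper subset of $\mathbb R^n$ with boundary $S_{\hat\theta}$. (b) If $\hat\theta\in\bigl(-n\tfrac{\pi}{2},\,-(n-2)\tfrac{\pi}{2}\bigr)$, then the level set is convex as well. More precisely, $S_{\hat\theta}$ is a connected component of the solution set of $(*)$, and it is the only one that is contained in $q-\Gamma_n$ for some $q\in\mathbb R^n$; moreover, the region $\{\lambda:\sum_i\arctan\lambda_i<\hat\theta\}$ is a nonempty convex open proper subset of $\mathbb R^n$ with boundary $S_{\hat\theta}$. -/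

import Mathlib

/-- The ratio `(ω + √-1 χ)ⁿ / ωⁿ` at a point, written in terms of the eigenvalues
`x 0, …, x (n - 1)` of `ω⁻¹ χ`. -/
noncomputable def dhymRatio {n : ℕ} (x : Fin n → ℝ) : ℂ :=
  ∏ j, (1 + Complex.I * (x j : ℂ))

/-- All `x ∈ ℝⁿ` that satisfy the deformed Hermitian--Yang--Mills equation
`Im (ω + √-1 χ)ⁿ = tan θ · Re (ω + √-1 χ)ⁿ` in terms of eigenvalues. The equation is multiplied by
`cos θ`, so that it is meaningful (and reads `Re (ω + √-1 χ)ⁿ = 0`) where `tan θ` is infinite. -/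
noncomputable def dhymSolutionSet (n : ℕ) (θ : ℝ) : Set (Fin n → ℝ) :=
  {x | Real.cos θ * (dhymRatio x).im = Real.sin θ * (dhymRatio x).re}

theorem mem_dhymSolutionSet_iff_tan {n : ℕ} {θ : ℝ} (h : Real.cos θ ≠ 0) (x : Fin n → ℝ) :
    x ∈ dhymSolutionSet n θ ↔ (dhymRatio x).im = Real.tan θ * (dhymRatio x).re := by
  simp only [dhymSolutionSet, Set.mem_ofPred_eq, Real.tan_eq_sin_div_cos]
  field_simp

/-- The phase `∑ arctan xᵢ`. -/
noncomputable def dhymPhase {n : ℕ} (x : Fin n → ℝ) : ℝ := ∑ i, Real.arctan (x i)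

/-- The level set `{∑ arctan xᵢ = θ}` of the deformed Hermitian--Yang--Mills equation of
phase `θ`. -/
noncomputable def dhymLevelSet (n : ℕ) (θ : ℝ) : Set (Fin n → ℝ) := {x | dhymPhase x = θ}

/-- `C` is one of the connected components of the subspace `F`. -/
def IsConnectedComponentOf {X : Type*} [TopologicalSpace X] (C F : Set X) : Prop :=
  ∃ x ∈ F, C = connectedComponentIn F x

/-- `S` is a convex hypersurface in `ℝⁿ` with enclosed region `K`: the region `K` is a nonempty
convex open proper subset of `ℝⁿ`, and `S` is its boundary. -/
structure IsConvexHypersurface {n : ℕ} (S K : Set (Fin n → ℝ)) : Prop where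
  isOpen : IsOpen K
  nonempty : K.Nonempty
  ne_univ : K ≠ Set.univ
  convex : Convex ℝ K
  frontier_eq : frontier K = S

/-!
Since `1 + √-1 t = √(1 + t²) exp (√-1 arctan t)`, the argument of `∏ (1 + √-1 xᵢ)` is the phase
`∑ arctan xᵢ`, so `(*)` says that the phase lies in `θ + π ℤ`. In the coordinates `arctan xᵢ ∈
(-π/2, π/2)` a level set of the phase is a slice of a cube by a hyperplane, hence connected; as
`θ + π ℤ` is countable, the components of the solution set are exactly the nonempty level sets. A
nonempty level set is bounded below iff its value is supercritical, and the supercritical values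
form an interval of length `π`, which singles out the one with value `θ`.

For the convexity put `arccot = π/2 - arctan`, with values in `(0, π)`. For supercritical `θ`, the
inequality `θ < ∑ arctan xᵢ` reads `∑ arccot xᵢ < arccot a` for some real `a`. By induction on the
number of summands this condition is convex jointly in `x` and `a`: the subtraction formula
`arccot a - arccot t = arccot ((1 + a t) / (t - a))`, for `a < t`, removes one summand, and
`(1 + a t) / (t - a)` is a convex function of `(a, t)`. Part (b) follows from part (a) by `x ↦ -x`.
-/

open Real Set
open scoped Pointwise

section Topology

variable {X Y : Type*} [TopologicalSpace X] [TopologicalSpace Y]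

theorem connectedComponentIn_preimage_eq_fiber {f : X → Y} (hf : Continuous f) {T : Set Y}
    (hT : IsTotallyDisconnected T) {x : X} (hx : f x ∈ T) (hfiber : IsPreconnected (f ⁻¹' {f x})) :
    connectedComponentIn (f ⁻¹' T) x = f ⁻¹' {f x} := by
  apply Subset.antisymm
  · have himage : (f '' connectedComponentIn (f ⁻¹' T) x).Subsingleton :=
      hT _ (image_subset_iff.2 (connectedComponentIn_subset _ _))
        (isPreconnected_connectedComponentIn.image f hf.continuousOn)
    exact fun y hy => himage (mem_image_of_mem f hy)
      (mem_image_of_mem f (mem_connectedComponentIn hx))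
  · exact hfiber.subset_connectedComponentIn rfl
      (preimage_mono (singleton_subset_iff.2 hx))

theorem isConnectedComponentOf_preimage_iff {f : X → Y} (hf : Continuous f) {T : Set Y}
    (hT : IsTotallyDisconnected T) (hfiber : ∀ y ∈ T, IsPreconnected (f ⁻¹' {y})) {C : Set X} :
    IsConnectedComponentOf C (f ⁻¹' T) ↔ ∃ y ∈ T, C = f ⁻¹' {y} ∧ C.Nonempty := by
  constructor
  · rintro ⟨x, hx, rfl⟩
    exact ⟨f x, hx, connectedComponentIn_preimage_eq_fiber hf hT hx (hfiber _ hx),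
      x, mem_connectedComponentIn hx⟩
  · rintro ⟨_, hy, rfl, x, rfl⟩
    exact ⟨x, hy, (connectedComponentIn_preimage_eq_fiber hf hT hy (hfiber _ hy)).symm⟩

theorem IsConnectedComponentOf.image_homeomorph {C F : Set X} (h : IsConnectedComponentOf C F)
    (e : X ≃ₜ Y) : IsConnectedComponentOf (e '' C) (e '' F) := by
  obtain ⟨x, hx, rfl⟩ := h
  exact ⟨e x, mem_image_of_mem e hx, e.image_connectedComponentIn hx⟩

theorem isConnectedComponentOf_neg_iff [InvolutiveNeg X] [ContinuousNeg X] {C F : Set X} :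
    IsConnectedComponentOf (-C) (-F) ↔ IsConnectedComponentOf C F := by
  have neg {A B : Set X} (h : IsConnectedComponentOf A B) : IsConnectedComponentOf (-A) (-B) := by
    simpa only [Homeomorph.coe_neg, image_neg_eq_neg] using h.image_homeomorph (Homeomorph.neg X)
  exact ⟨fun h => by simpa only [neg_neg] using neg h, neg⟩

end Topology

theorem IsConvexHypersurface.neg {n : ℕ} {S K : Set (Fin n → ℝ)}
    (h : IsConvexHypersurface S K) : IsConvexHypersurface (-S) (-K) where
  isOpen := h.isOpen.neg
  nonempty := h.nonempty.neg
  ne_univ hK := h.ne_univ (by rw [← neg_neg K, hK, neg_univ])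
  convex := h.convex.neg
  frontier_eq := by
    rw [← h.frontier_eq]
    exact ((Homeomorph.neg (Fin n → ℝ)).preimage_frontier K).symm

section Bounds

variable {ι : Type*} {α : ι → Type*} [∀ i, Preorder (α i)] {C : Set (∀ i, α i)}

theorem exists_forall_lt_iff_bddBelow [∀ i, NoMinOrder (α i)] :
    (∃ q : ∀ i, α i, ∀ x ∈ C, ∀ i, q i < x i) ↔ BddBelow C := by
  constructor
  · rintro ⟨q, hq⟩
    exact ⟨q, fun x hx i => (hq x hx i).le⟩
  · rintro ⟨q, hq⟩
    choose p hp using fun i => exists_lt (q i)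
    exact ⟨p, fun x hx i => (hp i).trans_le (hq hx i)⟩

theorem exists_forall_gt_iff_bddAbove [∀ i, NoMaxOrder (α i)] :
    (∃ q : ∀ i, α i, ∀ x ∈ C, ∀ i, x i < q i) ↔ BddAbove C := by
  constructor
  · rintro ⟨q, hq⟩
    exact ⟨q, fun x hx i => (hq x hx i).le⟩
  · rintro ⟨q, hq⟩
    choose p hp using fun i => exists_gt (q i)
    exact ⟨p, fun x hx i => (hq hx i).trans_lt (hp i)⟩

end Bounds

section Arccot

/-- The inverse cotangent, with values in `(0, π)`. It turns lower bounds on the phase of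
`n` numbers into upper bounds on a sum of positive terms. -/
noncomputable def arccot (x : ℝ) : ℝ := π / 2 - arctan x

theorem arccot_pos (x : ℝ) : 0 < arccot x := sub_pos.2 (arctan_lt_pi_div_two x)

theorem arccot_strictAnti : StrictAnti arccot := fun _ _ h =>
  sub_lt_sub_left (arctan_strictMono h) _

theorem range_arccot : range arccot = Ioo 0 π := by
  have h : arccot = (π / 2 - ·) ∘ arctan := rfl
  rw [h, range_comp, range_arctan, image_const_sub_Ioo]
  congr 1 <;> ring

theorem arccot_one_add_mul_div_sub {a x : ℝ} (h : a < x) :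
    arccot ((1 + a * x) / (x - a)) = arccot a - arccot x := by
  have htan : tan (π / 2 - (arctan x - arctan a)) = (1 + a * x) / (x - a) := by
    rw [tan_pi_div_two_sub,
      tan_sub' ⟨fun _ => arctan_ne_mul_pi_div_two _, fun _ => arctan_ne_mul_pi_div_two _⟩,
      tan_arctan, tan_arctan, inv_div, mul_comm]
  have hlt := arctan_strictMono h
  rw [arccot, arctan_eq_of_tan_eq htan
    ⟨by linarith [neg_pi_div_two_lt_arctan a, arctan_lt_pi_div_two x], by linarith⟩]
  simp only [arccot]
  ring

theorem arccot_add_lt_arccot_iff {a x c : ℝ} (hc : 0 ≤ c) :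
    arccot x + c < arccot a ↔ a < x ∧ c < arccot ((1 + a * x) / (x - a)) := by
  constructor
  · intro h
    have hax : a < x := arccot_strictAnti.lt_iff_gt.1 (by linarith)
    exact ⟨hax, by rw [arccot_one_add_mul_div_sub hax]; linarith⟩
  · rintro ⟨hax, h⟩
    rw [arccot_one_add_mul_div_sub hax] at h
    linarith

theorem convexOn_one_add_sq_div :
    ConvexOn ℝ {p : ℝ × ℝ | 0 < p.2} fun p => (1 + p.1 ^ 2) / p.2 := by
  have hconv : Convex ℝ {p : ℝ × ℝ | 0 < p.2} :=
    convex_halfSpace_gt (LinearMap.snd ℝ ℝ ℝ).isLinear 0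
  refine ⟨hconv, ?_⟩
  rintro ⟨a, u⟩ (hu : 0 < u) ⟨b, v⟩ (hv : 0 < v) s t hs ht hst
  have hw : 0 < s * u + t * v :=
    hconv (x := (a, u)) (y := (b, v)) (mem_ofPred_eq ▸ hu) (mem_ofPred_eq ▸ hv) hs ht hst
  have hgap : s * ((1 + a ^ 2) / u) + t * ((1 + b ^ 2) / v)
      - (1 + (s * a + t * b) ^ 2) / (s * u + t * v)
      = s * t * ((u - v) ^ 2 + (a * v - b * u) ^ 2) / (u * v * (s * u + t * v)) := by
    obtain rfl : t = 1 - s := by linarith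
    field_simp
    ring
  simp only [Prod.smul_mk, Prod.mk_add_mk, smul_eq_mul]
  rw [← sub_nonneg, hgap]
  positivity

theorem convexOn_one_add_mul_div_sub :
    ConvexOn ℝ {p : ℝ × ℝ | p.1 < p.2} fun p => (1 + p.1 * p.2) / (p.2 - p.1) := by
  let shear : ℝ × ℝ →ₗ[ℝ] ℝ × ℝ :=
    (LinearMap.fst ℝ ℝ ℝ).prod (LinearMap.snd ℝ ℝ ℝ - LinearMap.fst ℝ ℝ ℝ)
  have hset : shear ⁻¹' {p : ℝ × ℝ | 0 < p.2} = {p : ℝ × ℝ | p.1 < p.2} :=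
    ext fun p => sub_pos (a := p.2)
  have hconv := convexOn_one_add_sq_div.comp_linearMap shear
  rw [hset] at hconv
  refine (((LinearMap.fst ℝ ℝ ℝ).convexOn hconv.1).add hconv).congr ?_
  rintro ⟨a, x⟩ (hax : a < x)
  have hxa : x - a ≠ 0 := (sub_pos.2 hax).ne'
  change a + (1 + a ^ 2) / (x - a) = (1 + a * x) / (x - a)
  field_simp
  ring

variable {ι : Type*}

theorem convex_setOf_sum_arccot_lt_arccot (S : Finset ι) :
    Convex ℝ {p : (ι → ℝ) × ℝ | ∑ i ∈ S, arccot (p.1 i) < arccot p.2} := by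
  classical
  induction S using Finset.induction_on with
  | empty =>
    simpa only [Finset.sum_empty, arccot_pos, ofPred_true] using convex_univ
  | insert i S hi ih =>
    have hsplit (x : ι → ℝ) (a : ℝ) : ∑ j ∈ insert i S, arccot (x j) < arccot a ↔
        a < x i ∧ ∑ j ∈ S, arccot (x j) < arccot ((1 + a * x i) / (x i - a)) := by
      rw [Finset.sum_insert hi,
        arccot_add_lt_arccot_iff (Finset.sum_nonneg fun j _ => (arccot_pos (x j)).le)]
    rintro ⟨x, a⟩ hx ⟨y, b⟩ hy s t hs ht hst
    obtain ⟨hax, hxS⟩ := (hsplit x a).1 hx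
    obtain ⟨hby, hyS⟩ := (hsplit y b).1 hy
    have hlt : s * a + t * b < s * x i + t * y i :=
      convexOn_one_add_mul_div_sub.1 (x := (a, x i)) hax (y := (b, y i)) hby hs ht hst
    have hle := convexOn_one_add_mul_div_sub.2 (x := (a, x i)) hax (y := (b, y i)) hby hs ht hst
    have hsum := ih (x := (x, (1 + a * x i) / (x i - a))) hxS
      (y := (y, (1 + b * y i) / (y i - b))) hyS hs ht hst
    exact (hsplit (s • x + t • y) (s * a + t * b)).2
      ⟨hlt, lt_of_lt_of_le hsum (arccot_strictAnti.antitone hle)⟩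

theorem convex_setOf_sum_arccot_lt (S : Finset ι) {c : ℝ} (hc : c ≤ π) :
    Convex ℝ {x : ι → ℝ | ∑ i ∈ S, arccot (x i) < c} := by
  intro x hx y hy s t hs ht hst
  obtain ⟨d, hd, hdc⟩ := exists_between (max_lt (mem_ofPred_eq ▸ hx) (mem_ofPred_eq ▸ hy))
  obtain ⟨hxd, hyd⟩ := max_lt_iff.1 hd
  have hd₀ : 0 < d := (Finset.sum_nonneg fun i _ => (arccot_pos (x i)).le).trans_lt hxd
  obtain ⟨a, rfl⟩ : d ∈ range arccot := range_arccot ▸ ⟨hd₀, hdc.trans_le hc⟩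
  have hconv := convex_setOf_sum_arccot_lt_arccot S (x := (x, a)) hxd (y := (y, a)) hyd hs ht hst
  have ha : s • a + t • a = a := Convex.combo_self hst a
  simp only [Prod.smul_mk, Prod.mk_add_mk, ha] at hconv
  exact lt_trans hconv hdc

end Arccot

section Phase

variable {n : ℕ}

theorem continuous_dhymPhase : Continuous (dhymPhase : (Fin n → ℝ) → ℝ) := by
  unfold dhymPhase
  fun_prop

theorem dhymPhase_neg (x : Fin n → ℝ) : dhymPhase (-x) = -dhymPhase x := by
  simp only [dhymPhase, Pi.neg_apply, arctan_neg, Finset.sum_neg_distrib]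

theorem dhymPhase_cons (t : ℝ) (x : Fin n → ℝ) :
    dhymPhase (Fin.cons t x : Fin (n + 1) → ℝ) = arctan t + dhymPhase x := by
  simp only [dhymPhase, Fin.sum_univ_succ, Fin.cons_zero, Fin.cons_succ]

theorem dhymPhase_const (t : ℝ) : dhymPhase (fun _ : Fin n => t) = n * arctan t := by
  simp only [dhymPhase, Finset.sum_const, Finset.card_univ, Fintype.card_fin, nsmul_eq_mul]

theorem sum_arccot (x : Fin n → ℝ) : ∑ i, arccot (x i) = n * π / 2 - dhymPhase x := by
  simp only [arccot, dhymPhase, Finset.sum_sub_distrib, Finset.sum_const, Finset.card_univ,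
    Fintype.card_fin, nsmul_eq_mul, mul_div_assoc]

theorem dhymPhase_lt [NeZero n] (x : Fin n → ℝ) : dhymPhase x < n * π / 2 := by
  rw [← sub_pos, ← sum_arccot]
  exact Finset.sum_pos (fun i _ => arccot_pos (x i)) Finset.univ_nonempty

theorem range_dhymPhase [NeZero n] :
    range (dhymPhase : (Fin n → ℝ) → ℝ) = Ioo (-(n * π / 2)) (n * π / 2) := by
  apply Subset.antisymm
  · rintro _ ⟨x, rfl⟩
    exact ⟨neg_lt.1 (dhymPhase_neg x ▸ dhymPhase_lt (-x)), dhymPhase_lt x⟩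
  · rintro φ ⟨hl, hu⟩
    have hn : (0 : ℝ) < n := Nat.cast_pos.2 (NeZero.pos n)
    obtain ⟨t, ht⟩ : φ / n ∈ range arctan := by
      rw [range_arctan, mem_Ioo, lt_div_iff₀ hn, div_lt_iff₀ hn]
      constructor <;> linarith
    exact ⟨fun _ => t, by rw [dhymPhase_const, ht, mul_div_cancel₀ φ hn.ne']⟩

theorem isOpenMap_piMap_arctan : IsOpenMap (Pi.map fun _ : Fin n => arctan) := by
  have harctan : IsOpenMap arctan :=
    isOpen_Ioo.isOpenMap_subtype_val.comp tanOrderIso.symm.toHomeomorph.isOpenMap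
  exact .piMap (fun _ => harctan) (by simp only [Filter.cofinite_eq_bot, Filter.eventually_bot])

theorem dhymPhase_eq_sum_proj_comp : (dhymPhase : (Fin n → ℝ) → ℝ) =
    (∑ i, ContinuousLinearMap.proj i : StrongDual ℝ (Fin n → ℝ)) ∘ Pi.map fun _ => arctan := by
  ext x
  simp only [dhymPhase, Function.comp_apply, sum_apply,
    ContinuousLinearMap.proj_apply, Pi.map_apply]

theorem isOpenMap_dhymPhase [NeZero n] : IsOpenMap (dhymPhase : (Fin n → ℝ) → ℝ) := by
  rw [dhymPhase_eq_sum_proj_comp]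
  refine (ContinuousLinearMap.isOpenMap_of_ne_zero _ fun h => ?_).comp isOpenMap_piMap_arctan
  have hn : (n : ℝ) = 0 := by simpa using congrArg (· 1) h
  exact NeZero.ne n (Nat.cast_eq_zero.1 hn)

theorem isPreconnected_dhymLevelSet (φ : ℝ) : IsPreconnected (dhymLevelSet n φ) := by
  have hcube : Convex ℝ (range (Pi.map fun _ : Fin n => arctan)) := by
    rw [range_piMap, range_arctan]
    exact convex_pi fun _ _ => convex_Ioo _ _
  have hslice := hcube.inter ((convex_singleton φ).linear_preimage
    (∑ i, ContinuousLinearMap.proj i : StrongDual ℝ (Fin n → ℝ)).toLinearMap)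
  have hlevel : dhymLevelSet n φ = dhymPhase ⁻¹' {φ} := rfl
  rw [hlevel, dhymPhase_eq_sum_proj_comp, preimage_comp, ← preimage_range_inter]
  exact hslice.isPreconnected.preimage_of_isOpenMap (.piMap fun _ => arctan_injective)
    isOpenMap_piMap_arctan inter_subset_left

theorem exp_arctan_mul_I (x : ℝ) :
    Complex.exp (arctan x * Complex.I) = cos (arctan x) * (1 + Complex.I * x) := by
  have hsin : sin (arctan x) = x * cos (arctan x) := by
    rw [← tan_mul_cos (cos_arctan_pos x).ne', tan_arctan]
  rw [Complex.exp_mul_I, ← Complex.ofReal_cos, ← Complex.ofReal_sin, hsin]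
  push_cast
  ring

theorem exp_dhymPhase_mul_I (x : Fin n → ℝ) :
    Complex.exp (dhymPhase x * Complex.I) =
      (∏ i, cos (arctan (x i)) : ℝ) * dhymRatio x := by
  simp only [dhymPhase, dhymRatio, Complex.ofReal_sum, Complex.ofReal_prod, Finset.sum_mul,
    Complex.exp_sum, exp_arctan_mul_I, Finset.prod_mul_distrib]

theorem mem_dhymSolutionSet_iff_sin_eq_zero {θ : ℝ} {x : Fin n → ℝ} :
    x ∈ dhymSolutionSet n θ ↔ sin (dhymPhase x - θ) = 0 := by
  have hr : 0 < ∏ i, cos (arctan (x i)) := Finset.prod_pos fun i _ => cos_arctan_pos (x i)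
  have hexp := exp_dhymPhase_mul_I x
  generalize ∏ i, cos (arctan (x i)) = r at hr hexp
  have hcos : cos (dhymPhase x) = r * (dhymRatio x).re := by
    rw [← Complex.exp_ofReal_mul_I_re, hexp, Complex.re_ofReal_mul]
  have hsin : sin (dhymPhase x) = r * (dhymRatio x).im := by
    rw [← Complex.exp_ofReal_mul_I_im, hexp, Complex.im_ofReal_mul]
  have hsub : sin (dhymPhase x - θ) =
      r * (cos θ * (dhymRatio x).im - sin θ * (dhymRatio x).re) := by
    rw [sin_sub, hcos, hsin]
    ring
  rw [hsub, mul_eq_zero, or_iff_right hr.ne', sub_eq_zero, dhymSolutionSet, mem_ofPred_eq]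

theorem dhymSolutionSet_eq_preimage (θ : ℝ) :
    dhymSolutionSet n θ = dhymPhase ⁻¹' range fun k : ℤ => θ + k * π := by
  ext x
  simp only [mem_dhymSolutionSet_iff_sin_eq_zero, sin_eq_zero_iff, mem_preimage, mem_range,
    eq_sub_iff_add_eq']

theorem isConnectedComponentOf_dhymSolutionSet_iff {θ : ℝ} {C : Set (Fin n → ℝ)} :
    IsConnectedComponentOf C (dhymSolutionSet n θ) ↔
      ∃ k : ℤ, C = dhymLevelSet n (θ + k * π) ∧ C.Nonempty := by
  rw [dhymSolutionSet_eq_preimage, isConnectedComponentOf_preimage_iff continuous_dhymPhase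
    (countable_range _).isTotallyDisconnected fun φ _ => isPreconnected_dhymLevelSet φ]
  exact exists_range_iff

theorem neg_dhymLevelSet (φ : ℝ) : -dhymLevelSet n φ = dhymLevelSet n (-φ) := by
  ext x
  simp only [dhymLevelSet, mem_neg, mem_ofPred_eq, dhymPhase_neg, neg_eq_iff_eq_neg]

theorem neg_dhymSolutionSet (θ : ℝ) : -dhymSolutionSet n θ = dhymSolutionSet n (-θ) := by
  ext x
  rw [mem_neg, mem_dhymSolutionSet_iff_sin_eq_zero, mem_dhymSolutionSet_iff_sin_eq_zero,
    dhymPhase_neg, ← neg_eq_zero, ← sin_neg]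
  ring_nf

end Phase

section Supercritical

variable {n : ℕ}

/-- The supercritical phases in dimension `n`, an interval of length `π`. For `n ≥ 1` they are the
phases whose level sets are nonempty and bounded below. -/
def supercriticalPhases (n : ℕ) : Set ℝ := Ioo (((n : ℝ) - 2) * π / 2) (n * π / 2)

theorem mem_supercriticalPhases_iff {θ : ℝ} :
    θ ∈ supercriticalPhases n ↔ n * π / 2 - θ ∈ range arccot := by
  rw [range_arccot, supercriticalPhases, mem_Ioo, mem_Ioo]
  constructor <;> rintro ⟨_, _⟩ <;> constructor <;> linarith

theorem supercriticalPhases_subset_range_dhymPhase [NeZero n] :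
    supercriticalPhases n ⊆ range (dhymPhase : (Fin n → ℝ) → ℝ) := by
  have hn : (1 : ℝ) ≤ n := Nat.one_le_cast.2 NeZero.one_le
  rw [range_dhymPhase]
  exact Ioo_subset_Ioo_left (by nlinarith [pi_pos])

theorem bddBelow_dhymLevelSet {φ : ℝ} (hφ : φ ∈ supercriticalPhases n) :
    BddBelow (dhymLevelSet n φ) := by
  obtain ⟨a, ha⟩ := mem_supercriticalPhases_iff.1 hφ
  refine ⟨fun _ => a, fun x hx i => arccot_strictAnti.le_iff_ge.1 ?_⟩
  calc
    arccot (x i) ≤ ∑ j, arccot (x j) :=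
      Finset.single_le_sum (fun j _ => (arccot_pos (x j)).le) (Finset.mem_univ i)
    _ = n * π / 2 - φ := by rw [sum_arccot, show dhymPhase x = φ from hx]
    _ = arccot a := ha.symm

theorem not_bddBelow_dhymLevelSet [NeZero n] {φ : ℝ} (hl : -((n + 1 : ℕ) * π / 2) < φ)
    (hu : φ ≤ ((n + 1 : ℕ) - 2 : ℝ) * π / 2) : ¬BddBelow (dhymLevelSet (n + 1) φ) := by
  rintro ⟨q, hq⟩
  push_cast at hl hu
  obtain ⟨s, hs, hs'⟩ : ∃ s, -(π / 2) < s ∧ s < min (arctan (q 0)) (φ + n * π / 2) :=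
    exists_between (lt_min (neg_pi_div_two_lt_arctan _) (by linarith))
  obtain ⟨hsq, hsφ⟩ := lt_min_iff.1 hs'
  obtain ⟨t, rfl⟩ : s ∈ range arctan :=
    range_arctan ▸ ⟨hs, hsq.trans (arctan_lt_pi_div_two _)⟩
  obtain ⟨y, hy⟩ : φ - arctan t ∈ range (dhymPhase : (Fin n → ℝ) → ℝ) := by
    rw [range_dhymPhase]
    constructor <;> linarith
  have hmem : (Fin.cons t y : Fin (n + 1) → ℝ) ∈ dhymLevelSet (n + 1) φ := by
    rw [dhymLevelSet, mem_ofPred_eq, dhymPhase_cons, hy, add_sub_cancel]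
  exact (arctan_lt_arctan_iff.1 hsq).not_ge (hq hmem 0)

theorem nonempty_and_bddBelow_dhymLevelSet_iff [NeZero n] {φ : ℝ} :
    (dhymLevelSet n φ).Nonempty ∧ BddBelow (dhymLevelSet n φ) ↔ φ ∈ supercriticalPhases n := by
  refine ⟨?_, fun hφ =>
    ⟨supercriticalPhases_subset_range_dhymPhase hφ, bddBelow_dhymLevelSet hφ⟩⟩
  rintro ⟨hne, hbdd⟩
  obtain ⟨hl, hu⟩ : φ ∈ Ioo (-(n * π / 2)) (n * π / 2) := range_dhymPhase (n := n) ▸ hne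
  refine ⟨lt_of_not_ge fun hφ => ?_, hu⟩
  obtain ⟨m, rfl⟩ := Nat.exists_eq_succ_of_ne_zero (NeZero.ne n)
  have : NeZero m := ⟨by
    rintro rfl
    norm_num at hl hφ
    linarith⟩
  exact not_bddBelow_dhymLevelSet hl hφ hbdd

theorem eq_zero_of_add_mul_pi_mem_supercriticalPhases {θ : ℝ} {k : ℤ}
    (hθ : θ ∈ supercriticalPhases n) (hk : θ + k * π ∈ supercriticalPhases n) : k = 0 := by
  have habs : |(k : ℝ)| * π < 1 * π := by
    rw [← abs_of_pos pi_pos, ← abs_mul, abs_of_pos pi_pos, abs_lt]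
    constructor <;> linarith [hθ.1, hθ.2, hk.1, hk.2]
  rw [← Int.abs_lt_one_iff]
  exact_mod_cast lt_of_mul_lt_mul_right habs pi_pos.le

theorem isConnectedComponentOf_and_bddBelow_iff [NeZero n] {θ : ℝ}
    (hθ : θ ∈ supercriticalPhases n) {C : Set (Fin n → ℝ)} :
    IsConnectedComponentOf C (dhymSolutionSet n θ) ∧ BddBelow C ↔ C = dhymLevelSet n θ := by
  rw [isConnectedComponentOf_dhymSolutionSet_iff]
  constructor
  · rintro ⟨⟨k, rfl, hne⟩, hbdd⟩
    have hk := nonempty_and_bddBelow_dhymLevelSet_iff.1 ⟨hne, hbdd⟩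
    simp [eq_zero_of_add_mul_pi_mem_supercriticalPhases hθ hk]
  · rintro rfl
    obtain ⟨hne, hbdd⟩ := nonempty_and_bddBelow_dhymLevelSet_iff.2 hθ
    exact ⟨⟨0, by simp, hne⟩, hbdd⟩

theorem convex_setOf_lt_dhymPhase {θ : ℝ} (hθ : ((n : ℝ) - 2) * π / 2 ≤ θ) :
    Convex ℝ {x : Fin n → ℝ | θ < dhymPhase x} := by
  have h := convex_setOf_sum_arccot_lt (Finset.univ : Finset (Fin n)) (c := n * π / 2 - θ)
    (by linarith)
  simpa only [sum_arccot, sub_lt_sub_iff_left] using h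

theorem isConvexHypersurface_dhymLevelSet [NeZero n] {θ : ℝ} (hθ : θ ∈ supercriticalPhases n) :
    IsConvexHypersurface (dhymLevelSet n θ) {x | θ < dhymPhase x} where
  isOpen := isOpen_lt continuous_const continuous_dhymPhase
  nonempty := by
    obtain ⟨φ, hθφ, hφ⟩ := exists_between hθ.2
    obtain ⟨x, rfl⟩ := supercriticalPhases_subset_range_dhymPhase ⟨hθ.1.trans hθφ, hφ⟩
    exact ⟨x, hθφ⟩
  ne_univ h := by
    obtain ⟨x, rfl⟩ := supercriticalPhases_subset_range_dhymPhase hθ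
    have hx : dhymPhase x < dhymPhase x := h.ge (mem_univ x)
    exact lt_irrefl _ hx
  convex := convex_setOf_lt_dhymPhase hθ.1.le
  frontier_eq := calc
    frontier (dhymPhase ⁻¹' Ioi θ) = dhymPhase ⁻¹' frontier (Ioi θ) :=
      (isOpenMap_dhymPhase.preimage_frontier_eq_frontier_preimage continuous_dhymPhase _).symm
    _ = dhymPhase ⁻¹' {θ} := by rw [frontier_Ioi]

end Supercritical

theorem mainTheorem9 (n : ℕ) (hn : 1 ≤ n) (θ : ℝ) :
    (θ ∈ Set.Ioo (((n : ℝ) - 2) * Real.pi / 2) ((n : ℝ) * Real.pi / 2) →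
      (∀ C : Set (Fin n → ℝ),
        (IsConnectedComponentOf C (dhymSolutionSet n θ) ∧
          ∃ q : Fin n → ℝ, ∀ x ∈ C, ∀ i, q i < x i) ↔ C = dhymLevelSet n θ) ∧
      IsConvexHypersurface (dhymLevelSet n θ) {x | θ < dhymPhase x}) ∧
    (θ ∈ Set.Ioo (-((n : ℝ) * Real.pi / 2)) (-(((n : ℝ) - 2) * Real.pi / 2)) →
      (∀ C : Set (Fin n → ℝ),
        (IsConnectedComponentOf C (dhymSolutionSet n θ) ∧
          ∃ q : Fin n → ℝ, ∀ x ∈ C, ∀ i, x i < q i) ↔ C = dhymLevelSet n θ) ∧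
      IsConvexHypersurface (dhymLevelSet n θ) {x | dhymPhase x < θ}) := by
  have : NeZero n := ⟨Nat.one_le_iff_ne_zero.1 hn⟩
  refine ⟨fun hθ => ⟨fun C => ?_, isConvexHypersurface_dhymLevelSet hθ⟩, fun hθ => ?_⟩
  · rw [exists_forall_lt_iff_bddBelow]
    exact isConnectedComponentOf_and_bddBelow_iff hθ
  · have hneg : -θ ∈ supercriticalPhases n := ⟨lt_neg.1 hθ.2, neg_lt.1 hθ.1⟩
    constructor
    · intro C
      rw [exists_forall_gt_iff_bddAbove, ← isConnectedComponentOf_neg_iff, ← bddBelow_neg,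
        neg_dhymSolutionSet, isConnectedComponentOf_and_bddBelow_iff hneg, ← neg_dhymLevelSet,
        neg_inj]
    · have hregion : -{x : Fin n → ℝ | -θ < dhymPhase x} = {x | dhymPhase x < θ} := by
        ext x
        simp only [mem_neg, mem_ofPred_eq, dhymPhase_neg, neg_lt_neg_iff]
      simpa only [neg_dhymLevelSet, neg_neg, hregion] using
        (isConvexHypersurface_dhymLevelSet hneg).neg
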